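/- Let $\mathbb{CP}(1) = \mathbb{C} \cup \{\infty\}$ be the Riemann sphere, and let $\overline{\mathbb{D}} = \{z \in \mathbb{C} : |z| \le 1\}$. A closed disc in $\mathbb{CP}(1)$ is a set $D \subset \mathbb{CP}(1)$ that is the image of $\overline{\mathbb{D}}$ under a Möbius transformation $z \mapsto \frac{az+b}{cz+d}$ with $a,b,c,d \in \mathbb{C}$, $ad - bc \neq 0$. (Equivalently, $D$ is a closed disc of positive radius in $\mathbb{C}$, or a closed half-plane of $\mathbb{C}$ together with $\infty$, or the complement in $\mathbb{CP}(1)$ of an open disc of positive radius in $\mathbb{C}$.) Let $A \subset \mathbb{CP}(1)$ be any set with exactly six elements. Then there exist three pairwise disjoint closed discs $D_1, D_2, D_3 \subset \mathbb{CP}(1)$ such that, for every $j \in \{1,2,3\}$, the intersection $D_j \cap A$ consists of exactly two points. -/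

import Mathlib

/-- The image in the Riemann sphere `OnePoint ℂ = ℂ ∪ {∞}` of the closed unit disc of `ℂ`. -/
def closedUnitDisc : Set (OnePoint ℂ) :=
  (fun z : ℂ => (z : OnePoint ℂ)) '' Metric.closedBall (0 : ℂ) 1

/-- A closed disc in the Riemann sphere: the image of the closed unit disc under a Möbius
transformation. The action of `GL (Fin 2) ℂ` on `OnePoint ℂ` is the one by the fractional
linear maps `z ↦ (a z + b) / (c z + d)`, with `a d - b c ≠ 0`. -/
def IsClosedDisc (D : Set (OnePoint ℂ)) : Prop :=
  ∃ g : Matrix.GeneralLinearGroup (Fin 2) ℂ, D = (fun x => g • x) '' closedUnitDisc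

/-! On the unit sphere, a pair `a`, `b` spans a smallest cap, cut off by the plane through `a` and
`b` that perpendicularly bisects the segment from `0` to `p = a + b`. Two such caps are disjoint
once `⟪p, q⟫ ≤ 0` and the triangle `0 p q` has circumradius greater than `1`.

Choose the pairing that maximises the sum of inner products within pairs. Re-pairing two pairs gains
nothing, which gives `⟪p, q⟫ ≤ ‖p‖² + ‖q‖² - 4`. If the six points sum to zero, then `p + q` is
minus the third pair sum, so `‖p + q‖ < 2`. These two bounds force the circumradius condition
(`circumradius_inequality`), hence `exists_pairing_disjoint_caps`.

The sum is made zero by a Möbius map (`exists_sum_bloch_eq_zero`): the sum of the Busemann functions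
of the points is proper on hyperbolic 3-space, and at its minimum, moved to the base point, the
vanishing gradient says that the points sum to zero. Möbius maps preserve discs, and spherical caps
are discs (`isClosedDisc_setOf_le_inner_bloch`). -/

/-! ### Optimal pairings and disjoint caps on the unit sphere -/

section Matching

open scoped InnerProductSpace

variable {V : Type*} [NormedAddCommGroup V] [InnerProductSpace ℝ V]

/-- With `P = ‖p‖²`, `Q = ‖q‖²`, `d = ⟪p, q⟫`: the half-planes beyond the perpendicular bisectors of
`0 p` and `0 q` do not meet in the unit ball as soon as the circumradius of `0 p q` exceeds `1`. -/
theorem bisector_halfspaces_disjoint_on_sphere {p q x : V} (hx : ‖x‖ = 1)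
    (hd : ⟪p, q⟫_ℝ ≤ 0)
    (hf : 4 * (‖p‖ ^ 2 * ‖q‖ ^ 2 - ⟪p, q⟫_ℝ ^ 2) <
      ‖p‖ ^ 2 * ‖q‖ ^ 2 * (‖p‖ ^ 2 + ‖q‖ ^ 2 - 2 * ⟪p, q⟫_ℝ))
    (hp : ‖p‖ ^ 2 / 2 ≤ ⟪x, p⟫_ℝ) (hq : ‖q‖ ^ 2 / 2 ≤ ⟪x, q⟫_ℝ) : False := by
  set P := ‖p‖ ^ 2 with hP
  set Q := ‖q‖ ^ 2 with hQ
  set d := ⟪p, q⟫_ℝ with hd'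
  have hP0 : 0 ≤ P := by positivity
  have hQ0 : 0 ≤ Q := by positivity
  have hΔ : d ^ 2 ≤ P * Q := by
    have h := abs_real_inner_le_norm p q
    have h2 := sq_le_sq' (by linarith [neg_abs_le d, abs_nonneg d]) (le_trans (le_abs_self _) h)
    calc d ^ 2 ≤ (‖p‖ * ‖q‖) ^ 2 := h2
      _ = P * Q := by rw [hP, hQ]; ring
  -- A multiple of the circumcentre of `0 p q`. Since `d ≤ 0`, its coefficients are nonnegative, so
  -- the two half-space inequalities can be combined.
  set w := (Q * (P - d)) • p + (P * (Q - d)) • q with hw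
  have hww : ‖w‖ ^ 2 = (P * Q - d ^ 2) * (P * Q * (P + Q - 2 * d)) := by
    rw [hw, norm_add_sq_real, norm_smul, norm_smul, inner_smul_left, inner_smul_right, mul_pow,
      mul_pow, Real.norm_eq_abs, Real.norm_eq_abs, sq_abs, sq_abs, ← hP, ← hQ, ← hd']
    simp only [conj_trivial]
    ring
  have hxw : P * Q * (P + Q - 2 * d) / 2 ≤ ⟪x, w⟫_ℝ := by
    rw [hw, inner_add_right, inner_smul_right, inner_smul_right]
    have h1 := mul_le_mul_of_nonneg_left hp (mul_nonneg hQ0 (by linarith : 0 ≤ P - d))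
    have h2 := mul_le_mul_of_nonneg_left hq (mul_nonneg hP0 (by linarith : 0 ≤ Q - d))
    nlinarith
  have hcs : ⟪x, w⟫_ℝ ≤ ‖w‖ := by
    simpa [hx] using real_inner_le_norm x w
  set S := P * Q * (P + Q - 2 * d) with hS
  have hS0 : 0 < S := by nlinarith
  have : (S / 2) ^ 2 ≤ ‖w‖ ^ 2 := by
    have : S / 2 ≤ ‖w‖ := hxw.trans hcs
    gcongr
  rw [hww] at this
  nlinarith

/-- The circumradius condition holds for `P = ‖p‖²`, `Q = ‖q‖²`, `d = ⟪p, q⟫` when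
`‖p + q‖² = P + Q + 2 d < 4` and `d ≤ P + Q - 4`. -/
theorem circumradius_inequality {P Q d : ℝ} (hP : P < 4) (hQ : Q < 4)
    (hP0 : 0 ≤ P) (hQ0 : 0 ≤ Q) (hd : d ≤ P + Q - 4) (hR : P + Q + 2 * d < 4) :
    d ≤ 0 ∧ 4 * (P * Q - d ^ 2) < P * Q * (P + Q - 2 * d) := by
  have hPQ : 0 ≤ P * Q := mul_nonneg hP0 hQ0
  have hd0 : d ≤ 0 := by linarith
  refine ⟨hd0, ?_⟩
  rcases lt_trichotomy (P + Q) 4 with h | h | h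
  · -- at `d = P + Q - 4` the difference is `(4 - P - Q) (4 - P) (4 - Q)`
    have h1 : 0 < (4 - P - Q) * ((4 - P) * (4 - Q)) :=
      mul_pos (by linarith) (mul_pos (by linarith) (by linarith))
    have h2 : 0 ≤ (P + Q - 4 - d) * (2 * (P * Q) - 4 * (d + (P + Q - 4))) :=
      mul_nonneg (by linarith) (by linarith)
    nlinarith
  · have hd1 : d < 0 := by linarith
    rw [h]
    nlinarith [mul_nonneg hPQ (by linarith : 0 ≤ -d), mul_pos_of_neg_of_neg hd1 hd1]
  · have h1 : 0 < 4 * (P + Q - 4) ^ 2 := by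
      have : 0 < P + Q - 4 := by linarith
      positivity
    have hd1 : d < 0 := by linarith
    nlinarith [mul_nonneg hPQ (by linarith : 0 ≤ P + Q - 4), mul_pos_of_neg_of_neg hd1 hd1,
      mul_nonneg hPQ (by linarith : 0 ≤ -d)]

theorem exists_pairing_disjoint_caps (u : Fin 3 × Bool → V) (hu : ∀ i, ‖u i‖ = 1)
    (hne : ∀ i j, i ≠ j → ⟪u i, u j⟫_ℝ < 1) (hsum : ∑ i, u i = 0) :
    ∃ σ : Equiv.Perm (Fin 3 × Bool),
      (∀ i, 0 < ‖u (σ (i, true)) + u (σ (i, false))‖ ^ 2 ∧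
        ‖u (σ (i, true)) + u (σ (i, false))‖ ^ 2 < 4) ∧
      ∀ i j, i ≠ j → ∀ x : V, ‖x‖ = 1 →
        ‖u (σ (i, true)) + u (σ (i, false))‖ ^ 2 / 2 ≤
          ⟪x, u (σ (i, true)) + u (σ (i, false))⟫_ℝ →
        ‖u (σ (j, true)) + u (σ (j, false))‖ ^ 2 / 2 ≤
          ⟪x, u (σ (j, true)) + u (σ (j, false))⟫_ℝ → False := by
  obtain ⟨σ, hσ⟩ := Finite.exists_max
    (fun σ : Equiv.Perm (Fin 3 × Bool) => ∑ k, ⟪u (σ (k, true)), u (σ (k, false))⟫_ℝ)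
  set a : Fin 3 → V := fun k => u (σ (k, true)) with ha
  set b : Fin 3 → V := fun k => u (σ (k, false)) with hb
  have hab : ∀ k, ⟪a k, b k⟫_ℝ < 1 := fun k => hne _ _ (by simp)
  have hnorm : ∀ k, ‖a k + b k‖ ^ 2 = 2 + 2 * ⟪a k, b k⟫_ℝ := fun k => by
    rw [norm_add_sq_real, show ‖a k‖ = 1 from hu _, show ‖b k‖ = 1 from hu _]; ring
  have hlt : ∀ k, ‖a k + b k‖ ^ 2 < 4 := fun k => by rw [hnorm]; linarith [hab k]
  have hsum' : ∑ k, (a k + b k) = 0 := by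
    rw [← hsum, ← Equiv.sum_comp σ, Fintype.sum_prod_type]
    simp [ha, hb]
  have swap1 : ∀ i j, i ≠ j → ⟪b j, b i⟫_ℝ + ⟪a j, a i⟫_ℝ ≤ ⟪a i, b i⟫_ℝ + ⟪a j, b j⟫_ℝ := by
    intro i j hij
    have h := hσ ((Equiv.swap (i, true) (j, false)).trans σ)
    simp only [Fin.sum_univ_three, Equiv.trans_apply, Equiv.swap_apply_def, Prod.mk.injEq] at h
    fin_cases i <;> fin_cases j <;> first | exact absurd rfl hij | skip
    all_goals
      simp [ha, hb] at h ⊢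
      linarith
  have swap2 : ∀ i j, i ≠ j → ⟪a j, b i⟫_ℝ + ⟪a i, b j⟫_ℝ ≤ ⟪a i, b i⟫_ℝ + ⟪a j, b j⟫_ℝ := by
    intro i j hij
    have h := hσ ((Equiv.swap (i, true) (j, true)).trans σ)
    simp only [Fin.sum_univ_three, Equiv.trans_apply, Equiv.swap_apply_def, Prod.mk.injEq] at h
    fin_cases i <;> fin_cases j <;> first | exact absurd rfl hij | skip
    all_goals
      simp [ha, hb] at h ⊢
      linarith
  have key : ∀ i j, i ≠ j → ⟪a i + b i, a j + b j⟫_ℝ ≤ 0 ∧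
      4 * (‖a i + b i‖ ^ 2 * ‖a j + b j‖ ^ 2 - ⟪a i + b i, a j + b j⟫_ℝ ^ 2) <
      ‖a i + b i‖ ^ 2 * ‖a j + b j‖ ^ 2 *
        (‖a i + b i‖ ^ 2 + ‖a j + b j‖ ^ 2 - 2 * ⟪a i + b i, a j + b j⟫_ℝ) := by
    intro i j hij
    apply circumradius_inequality (hlt i) (hlt j) (by positivity) (by positivity)
    -- The two re-pairings of four points together contain all four cross terms of `⟪a i + b i, a j
    -- + b j⟫`.
    · have h1 := swap1 i j hij
      have h2 := swap2 i j hij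
      rw [hnorm, hnorm]
      simp only [inner_add_left, inner_add_right]
      rw [real_inner_comm (a j) (a i), real_inner_comm (b j) (b i), real_inner_comm (a j) (b i)]
        at *
      linarith
    -- Having exactly three pairs matters here: the complement of two pairs is a single pair.
    · obtain ⟨k, hk⟩ : ∃ k, a i + b i + (a j + b j) = -(a k + b k) := by
        rw [Fin.sum_univ_three] at hsum'
        have h0 : a 0 + b 0 = -(a 1 + b 1 + (a 2 + b 2)) := by
          rw [eq_neg_iff_add_eq_zero, ← hsum']; abel
        fin_cases i <;> fin_cases j <;> first | exact absurd rfl hij | skip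
        all_goals simp only [Fin.zero_eta, Fin.mk_one, Fin.reduceFinMk, h0]
        exacts [⟨2, by abel⟩, ⟨1, by abel⟩, ⟨2, by abel⟩, ⟨0, by rw [h0]; abel⟩, ⟨1, by abel⟩,
          ⟨0, by rw [h0]; abel⟩]
      have h := norm_add_sq_real (a i + b i) (a j + b j)
      rw [hk, norm_neg] at h
      linarith [hlt k]
  refine ⟨σ, fun i => ⟨?_, hlt i⟩, fun i j hij x hx hi hj => ?_⟩
  · obtain ⟨j, hij⟩ := exists_ne i
    have := (key i j hij.symm).2
    have hcs := real_inner_mul_inner_self_le (a i + b i) (a j + b j)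
    -- If the pair sum vanished, both sides of the strict inequality in `key` would be zero.
    by_contra! h
    have h0 : ‖a i + b i‖ ^ 2 = 0 := le_antisymm h (by positivity)
    rw [real_inner_self_eq_norm_sq, h0] at hcs
    rw [h0] at this
    nlinarith
  · exact bisector_halfspaces_disjoint_on_sphere hx (key i j hij).1 (key i j hij).2 hi hj

end Matching

/-! ### Conformal barycenter: a Möbius map that balances the points -/

section Barycenter

open Complex

theorem exists_mulVec_eq (a b c d : ℂ) (h : a * d - b * c ≠ 0) :
    ∃ g : GL (Fin 2) ℂ, ∀ v : Fin 2 → ℂ,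
      g.1.mulVec v = ![a * v 0 + b * v 1, c * v 0 + d * v 1] :=
  ⟨Matrix.GeneralLinearGroup.mkOfDetNeZero !![a, b; c, d] (by rwa [Matrix.det_fin_two_of]),
    fun v => Matrix.mulVec_fin_two !![a, b; c, d] v⟩

theorem mulVec_ne_zero (g : GL (Fin 2) ℂ) {v : Fin 2 → ℂ} (hv : v ≠ 0) :
    g.1.mulVec v ≠ 0 := by
  intro h
  have := congrArg (g⁻¹.1.mulVec) h
  rw [Matrix.mulVec_mulVec, ← Units.val_mul, inv_mul_cancel, Units.val_one, Matrix.one_mulVec,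
    Matrix.mulVec_zero] at this
  exact hv this

/-- `(‖x - ζ y‖² + t² ‖y‖²) / t`: up to the scale of `(x, y)`, the exponential of the Busemann
function at `x / y` of the point `(ζ, t)` of the upper half-space. -/
noncomputable def horoHeight (v : Fin 2 → ℂ) (ζ : ℂ) (t : ℝ) : ℝ :=
  (normSq (v 0 - ζ * v 1) + t ^ 2 * normSq (v 1)) / t

/-- `v₀ w₁ - w₀ v₁` -/
def wedge (v w : Fin 2 → ℂ) : ℂ := v 0 * w 1 - w 0 * v 1

theorem horoHeight_nonneg (v : Fin 2 → ℂ) (ζ : ℂ) {t : ℝ} (ht : 0 < t) :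
    0 ≤ horoHeight v ζ t := by
  have := normSq_nonneg (v 0 - ζ * v 1)
  have := normSq_nonneg (v 1)
  unfold horoHeight
  positivity

/-- Lagrange's identity, the source of all lower bounds on heights below. -/
theorem normSq_wedge_add (v w : Fin 2 → ℂ) :
    normSq (wedge v w) + normSq (starRingEnd ℂ (v 0) * w 0 + starRingEnd ℂ (v 1) * w 1) =
      (normSq (v 0) + normSq (v 1)) * (normSq (w 0) + normSq (w 1)) := by
  simp only [wedge, normSq_apply, sub_re, sub_im, mul_re, mul_im, add_re, add_im, conj_re, conj_im]
  ring

theorem normSq_wedge_le (v w : Fin 2 → ℂ) :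
    normSq (wedge v w) ≤
      (normSq (v 0) + normSq (v 1)) * (normSq (w 0) + normSq (w 1)) := by
  have := normSq_wedge_add v w
  linarith [normSq_nonneg (starRingEnd ℂ (v 0) * w 0 + starRingEnd ℂ (v 1) * w 1)]

theorem normSq_wedge_le_horoHeight_mul (v w : Fin 2 → ℂ) (ζ : ℂ) {t : ℝ} (ht : 0 < t) :
    normSq (wedge v w) ≤ horoHeight v ζ t * horoHeight w ζ t := by
  have h := normSq_wedge_le ![v 0 - ζ * v 1, t * v 1] ![w 0 - ζ * w 1, t * w 1]
  have e : wedge ![v 0 - ζ * v 1, t * v 1] ![w 0 - ζ * w 1, t * w 1] = t * wedge v w := by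
    simp [wedge]; ring
  rw [e] at h
  simp only [Matrix.cons_val_zero, Matrix.cons_val_one, map_mul, normSq_ofReal] at h
  unfold horoHeight
  rw [div_mul_div_comm, le_div_iff₀ (by positivity)]
  linarith

/-- The factor `(1 + |ζ|² + t²) / t` is twice the cosh of the hyperbolic distance from `(0, 1)` to
`(ζ, t)`, so two distinct points cannot both have small height far away. It follows by applying
Cauchy–Schwarz to the rows of the matrix with columns `v`, `w`. -/
theorem normSq_wedge_mul_le_horoHeight_add (v w : Fin 2 → ℂ) (ζ : ℂ) {t : ℝ} (ht : 0 < t) :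
    normSq (wedge v w) * ((1 + normSq ζ + t ^ 2) / t) ≤
      (normSq (v 0) + normSq (v 1) + normSq (w 0) + normSq (w 1)) *
        (horoHeight v ζ t + horoHeight w ζ t) := by
  have h1 := normSq_wedge_le ![v 1, w 1] ![v 0 - ζ * v 1, w 0 - ζ * w 1]
  have h2 := normSq_wedge_le ![v 0, w 0] ![v 0 - ζ * v 1, w 0 - ζ * w 1]
  have e1 : normSq (wedge ![v 1, w 1] ![v 0 - ζ * v 1, w 0 - ζ * w 1]) = normSq (wedge v w) := by
    rw [← normSq_neg]; congr 1; simp [wedge]; ring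
  have e2 : normSq (wedge ![v 0, w 0] ![v 0 - ζ * v 1, w 0 - ζ * w 1]) =
      normSq ζ * normSq (wedge v w) := by
    rw [← map_mul, ← normSq_neg]; congr 1; simp [wedge]; ring
  have h3 := normSq_wedge_le ![v 0, w 0] ![t * v 1, t * w 1]
  have e3 : normSq (wedge ![v 0, w 0] ![t * v 1, t * w 1]) = t ^ 2 * normSq (wedge v w) := by
    rw [sq, ← normSq_ofReal, ← map_mul]; congr 1; simp [wedge]; ring
  rw [e1] at h1
  rw [e2] at h2
  rw [e3] at h3
  simp only [Matrix.cons_val_zero, Matrix.cons_val_one, map_mul, normSq_ofReal] at h1 h2 h3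
  unfold horoHeight
  rw [← add_div, mul_div_assoc', mul_div_assoc']
  refine div_le_div_of_nonneg_right ?_ ht.le
  linarith [sq_nonneg (t * (normSq (v 1) + normSq (w 1)))]

theorem exists_uniform_lower_bound {ι : Type*} [Finite ι] (v : ι → Fin 2 → ℂ)
    (hv : ∀ i j, i ≠ j → wedge (v i) (v j) ≠ 0) :
    ∃ c > 0, ∀ i j, i ≠ j → ∀ ζ : ℂ, ∀ t : ℝ, 0 < t →
      c ≤ horoHeight (v i) ζ t * horoHeight (v j) ζ t ∧
      c * ((1 + normSq ζ + t ^ 2) / t) ≤ horoHeight (v i) ζ t + horoHeight (v j) ζ t := by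
  have h : ∀ p : ι × ι, ∃ c > 0, ∀ c', c' ≤ c → p.1 ≠ p.2 → ∀ ζ : ℂ, ∀ t : ℝ, 0 < t →
      c' ≤ horoHeight (v p.1) ζ t * horoHeight (v p.2) ζ t ∧
      c' * ((1 + normSq ζ + t ^ 2) / t) ≤
        horoHeight (v p.1) ζ t + horoHeight (v p.2) ζ t := by
    rintro ⟨i, j⟩
    by_cases hij : i = j
    · exact ⟨1, one_pos, fun _ _ h => absurd hij h⟩
    set W := normSq (wedge (v i) (v j)) with hW
    have hW0 : 0 < W := normSq_pos.2 (hv i j hij)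
    set S := normSq (v i 0) + normSq (v i 1) + normSq (v j 0) + normSq (v j 1) with hS
    have hS0 : 0 ≤ S := by
      have := normSq_nonneg (v i 0)
      have := normSq_nonneg (v i 1)
      have := normSq_nonneg (v j 0)
      have := normSq_nonneg (v j 1)
      positivity
    refine ⟨W / (S + 1), by positivity, fun c' hc' _ ζ t ht => ⟨?_, ?_⟩⟩
    · refine le_trans (hc'.trans ?_) (normSq_wedge_le_horoHeight_mul (v i) (v j) ζ ht)
      exact div_le_self hW0.le (by linarith)
    · have h := normSq_wedge_mul_le_horoHeight_add (v i) (v j) ζ ht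
      rw [← hS, ← hW] at h
      have hτ : 0 ≤ (1 + normSq ζ + t ^ 2) / t := by
        have := normSq_nonneg ζ
        positivity
      have h0 := add_nonneg (horoHeight_nonneg (v i) ζ ht) (horoHeight_nonneg (v j) ζ ht)
      calc c' * ((1 + normSq ζ + t ^ 2) / t)
          ≤ W / (S + 1) * ((1 + normSq ζ + t ^ 2) / t) := by gcongr
        _ ≤ _ := by
          rw [div_mul_eq_mul_div, div_le_iff₀ (by positivity)]
          linarith
  choose c hc0 hc using h
  cases isEmpty_or_nonempty (ι × ι) with
  | inl h => exact ⟨1, one_pos, fun i j => (h.false (i, j)).elim⟩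
  | inr h =>
    obtain ⟨p, hp⟩ := Finite.exists_min c
    exact ⟨c p, hc0 p, fun i j hij => hc (i, j) (c p) (hp _) hij⟩

/-- Far away only the smallest height can be small. Its product with a second height is bounded
below, and a third one grows without bound; hence the need for three points. -/
theorem le_prod_horoHeight {ι : Type*} [Fintype ι] (hι : 3 ≤ Fintype.card ι)
    (v : ι → Fin 2 → ℂ) (hv : ∀ i j, i ≠ j → wedge (v i) (v j) ≠ 0) :
    ∃ c > 0, ∀ ζ : ℂ, ∀ t : ℝ, 0 < t → 1 ≤ c * ((1 + normSq ζ + t ^ 2) / t) →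
      c * (c * ((1 + normSq ζ + t ^ 2) / t)) ≤ ∏ i, horoHeight (v i) ζ t := by
  classical
  obtain ⟨c, hc0, hc⟩ := exists_uniform_lower_bound v hv
  refine ⟨c / 2, by positivity, fun ζ t ht hτ => ?_⟩
  set τ := (1 + normSq ζ + t ^ 2) / t
  have : Nonempty ι := Fintype.card_pos_iff.1 (by omega)
  obtain ⟨i, hi⟩ := Finite.exists_min fun i => horoHeight (v i) ζ t
  have hbig : ∀ j, j ≠ i → c / 2 * τ ≤ horoHeight (v j) ζ t := fun j hj => by
    have h1 := (hc i j hj.symm ζ t ht).2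
    have h2 := hi j
    linarith
  have : Nontrivial ι := Fintype.one_lt_card_iff_nontrivial.1 (by omega)
  obtain ⟨j, hj⟩ := exists_ne i
  obtain ⟨k, hk⟩ : ∃ k, k ∈ (Finset.univ.erase i).erase j := by
    apply Finset.card_pos.1
    rw [Finset.card_erase_of_mem (by simp [hj]), Finset.card_erase_of_mem (by simp),
      Finset.card_univ]
    omega
  have hrest : c / 2 * τ ≤ ∏ l ∈ (Finset.univ.erase i).erase j, horoHeight (v l) ζ t := by
    rw [← Finset.mul_prod_erase _ _ hk]
    have hki : k ≠ i := (Finset.mem_erase.1 (Finset.mem_erase.1 hk).2).1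
    refine (hbig k hki).trans (le_mul_of_one_le_right (horoHeight_nonneg _ _ ht) ?_)
    refine Finset.one_le_prod fun l hl => hτ.trans (hbig l ?_)
    exact (Finset.mem_erase.1 (Finset.mem_erase.1 (Finset.mem_erase.1 hl).2).2).1
  rw [← Finset.mul_prod_erase _ _ (Finset.mem_univ i),
    ← Finset.mul_prod_erase _ _ (Finset.mem_erase.2 ⟨hj, Finset.mem_univ j⟩)]
  have h1 := (hc i j hj.symm ζ t ht).1
  refine (mul_le_mul ?_ hrest (by linarith) (by linarith)).trans_eq (mul_assoc _ _ _)
  linarith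

theorem exists_min_prod_horoHeight {ι : Type*} [Fintype ι] (hι : 3 ≤ Fintype.card ι)
    (v : ι → Fin 2 → ℂ) (hv : ∀ i j, i ≠ j → wedge (v i) (v j) ≠ 0) :
    ∃ ζ₀ : ℂ, ∃ t₀ : ℝ, 0 < t₀ ∧ ∀ ζ : ℂ, ∀ t : ℝ, 0 < t →
      ∏ i, horoHeight (v i) ζ₀ t₀ ≤ ∏ i, horoHeight (v i) ζ t := by
  obtain ⟨c, hc0, hc⟩ := le_prod_horoHeight hι v hv
  set Φ : ℂ × ℝ → ℝ := fun p => ∏ i, horoHeight (v i) p.1 p.2 with hΦ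
  obtain ⟨T, hT2, hTc, hTΦ⟩ : ∃ T : ℝ, 2 ≤ T ∧ 1 ≤ c * T ∧ Φ (0, 1) ≤ c * (c * T) := by
    refine ⟨max 2 (max (1 / c) (Φ (0, 1) / (c * c))), le_max_left _ _, ?_, ?_⟩
    · rw [← div_le_iff₀' hc0]
      exact (le_max_left _ _).trans (le_max_right _ _)
    · rw [← mul_assoc, ← div_le_iff₀' (by positivity)]
      exact (le_max_right _ _).trans (le_max_right _ _)
  -- A closed hyperbolic ball about `(0, 1)`; `2 ≤ T` puts the centre in it.
  set K : Set (ℂ × ℝ) := {p | 1 + normSq p.1 + p.2 ^ 2 ≤ T * p.2} with hK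
  have hKpos : ∀ p ∈ K, 0 < p.2 := fun p hp => by
    have hp : 1 + normSq p.1 + p.2 ^ 2 ≤ T * p.2 := hp
    have : 0 < T * p.2 := by nlinarith [normSq_nonneg p.1, sq_nonneg p.2]
    exact pos_of_mul_pos_right this (by linarith)
  have hKc : IsCompact K := by
    apply Metric.isCompact_of_isClosed_isBounded
    · apply isClosed_le <;> fun_prop
    · refine (Metric.isBounded_closedBall (x := (0 : ℂ × ℝ)) (r := T)).subset fun p hp => ?_
      have h0 := hKpos p hp
      have hp : 1 + normSq p.1 + p.2 ^ 2 ≤ T * p.2 := hp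
      have h1 : p.2 ≤ T := by nlinarith [normSq_nonneg p.1]
      rw [mem_closedBall_zero_iff, Prod.norm_def, max_le_iff, Real.norm_eq_abs, abs_of_pos h0]
      refine ⟨le_of_sq_le_sq ?_ (by linarith), h1⟩
      rw [← normSq_eq_norm_sq]
      nlinarith
  have hcont : ContinuousOn Φ K := by
    apply continuousOn_finsetProd
    intro i _
    unfold horoHeight
    apply ContinuousOn.div
    · fun_prop
    · fun_prop
    · exact fun p hp => (hKpos p hp).ne'
  have hmem : ((0, 1) : ℂ × ℝ) ∈ K := by simp [hK]; linarith
  obtain ⟨m, hmK, hm⟩ := hKc.exists_isMinOn ⟨_, hmem⟩ hcont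
  rw [isMinOn_iff] at hm
  refine ⟨m.1, m.2, hKpos m hmK, fun ζ t ht => ?_⟩
  by_cases hin : (ζ, t) ∈ K
  · exact hm (ζ, t) hin
  · have hτ : T ≤ (1 + normSq ζ + t ^ 2) / t := by
      rw [le_div_iff₀ ht]
      exact (not_le.1 hin).le
    calc _ ≤ Φ (0, 1) := hm (0, 1) hmem
      _ ≤ c * (c * T) := hTΦ
      _ ≤ c * (c * ((1 + normSq ζ + t ^ 2) / t)) := by gcongr
      _ ≤ _ := hc ζ t ht (hTc.trans (by gcongr))

theorem sum_div_eq_zero_of_prod_min {ι : Type*} [Fintype ι] {f : ι → ℝ → ℝ} {f' : ι → ℝ}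
    (hf : ∀ i, HasDerivAt (f i) (f' i) 0) (hpos : ∀ i s, 0 < f i s)
    (hmin : ∀ s, ∏ i, f i 0 ≤ ∏ i, f i s) : ∑ i, f' i / f i 0 = 0 := by
  have h : HasDerivAt (fun s => ∑ i, Real.log (f i s)) (∑ i, f' i / f i 0) 0 :=
    HasDerivAt.fun_sum fun i _ => (hf i).log (hpos i 0).ne'
  refine IsLocalMin.hasDerivAt_eq_zero (Filter.Eventually.of_forall fun s => ?_) h
  rw [← Real.log_prod fun i _ => (hpos i 0).ne', ← Real.log_prod fun i _ => (hpos i s).ne']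
  exact Real.log_le_log (Finset.prod_pos fun i _ => hpos i 0) (hmin s)

/-- The point of the unit sphere of `ℝ³` that corresponds to the line spanned by `v`. -/
noncomputable def bloch (v : Fin 2 → ℂ) : EuclideanSpace ℝ (Fin 3) :=
  WithLp.toLp 2 ![2 * (starRingEnd ℂ (v 0) * v 1).re / (normSq (v 0) + normSq (v 1)),
    2 * (starRingEnd ℂ (v 0) * v 1).im / (normSq (v 0) + normSq (v 1)),
    (normSq (v 0) - normSq (v 1)) / (normSq (v 0) + normSq (v 1))]

theorem normSq_add_normSq_pos {v : Fin 2 → ℂ} (hv : v ≠ 0) :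
    0 < normSq (v 0) + normSq (v 1) := by
  by_contra! h
  have h0 := normSq_nonneg (v 0)
  have h1 := normSq_nonneg (v 1)
  apply hv
  have e0 : normSq (v 0) = 0 := by linarith
  have e1 : normSq (v 1) = 0 := by linarith
  ext i
  fin_cases i
  exacts [normSq_eq_zero.1 e0, normSq_eq_zero.1 e1]

theorem inner_bloch {v w : Fin 2 → ℂ} (hv : v ≠ 0) (hw : w ≠ 0) :
    inner ℝ (bloch v) (bloch w) = 1 - 2 * (normSq (wedge v w) /
      ((normSq (v 0) + normSq (v 1)) * (normSq (w 0) + normSq (w 1)))) := by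
  have h1 := (normSq_add_normSq_pos hv).ne'
  have h2 := (normSq_add_normSq_pos hw).ne'
  simp only [bloch, PiLp.inner_apply, Fin.sum_univ_three, Matrix.cons_val_zero,
    Matrix.cons_val_one, Matrix.cons_val, RCLike.inner_apply, conj_trivial]
  field_simp
  simp only [wedge, normSq_apply, sub_re, sub_im, mul_re, mul_im, conj_re, conj_im]
  ring

theorem norm_bloch {v : Fin 2 → ℂ} (hv : v ≠ 0) : ‖bloch v‖ = 1 := by
  have h := inner_bloch hv hv
  rw [real_inner_self_eq_norm_sq] at h
  have h0 : wedge v v = 0 := by simp [wedge]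
  rw [h0, map_zero, zero_div, mul_zero, sub_zero] at h
  exact (pow_eq_one_iff_of_nonneg (norm_nonneg _) two_ne_zero).1 h

theorem sum_bloch_eq_zero {ι : Type*} [Fintype ι] (w : ι → Fin 2 → ℂ) (hw : ∀ i, w i ≠ 0)
    (hmin : ∀ ζ : ℂ, ∀ t : ℝ, 0 < t →
      ∏ i, horoHeight (w i) 0 1 ≤ ∏ i, horoHeight (w i) ζ t) :
    ∑ i, bloch (w i) = 0 := by
  have h01 : ∀ i, horoHeight (w i) 0 1 = normSq (w i 0) + normSq (w i 1) := fun i => by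
    simp [horoHeight]
  have hpos : ∀ i ζ t, 0 < t → 0 < horoHeight (w i) ζ t := fun i ζ t ht => by
    have h : (![w i 0 - ζ * w i 1, t * w i 1] : Fin 2 → ℂ) ≠ 0 := by
      intro h
      have h1 : (t : ℂ) * w i 1 = 0 := congrFun h 1
      have h1 : w i 1 = 0 := by simpa [ht.ne'] using h1
      have h0 : w i 0 - ζ * w i 1 = 0 := congrFun h 0
      have h0 : w i 0 = 0 := by simpa [h1] using h0
      apply hw i
      ext k
      fin_cases k
      exacts [h0, h1]
    have := normSq_add_normSq_pos h
    simp only [Matrix.cons_val_zero, Matrix.cons_val_one, map_mul, normSq_ofReal] at this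
    unfold horoHeight
    rw [sq]
    positivity
  have hζ : ∀ ξ : ℂ, ∑ i, (-2 * (starRingEnd ℂ (w i 0) * (ξ * w i 1)).re) /
      (normSq (w i 0) + normSq (w i 1)) = 0 := by
    intro ξ
    have h := sum_div_eq_zero_of_prod_min
      (f := fun i (s : ℝ) => horoHeight (w i) (s * ξ) 1)
      (f' := fun i => -2 * (starRingEnd ℂ (w i 0) * (ξ * w i 1)).re)
      (fun i => ?_) (fun i s => hpos i _ _ one_pos) (fun s => ?_)
    · simpa [h01] using h
    · have e : (fun s : ℝ => horoHeight (w i) (s * ξ) 1) = fun s : ℝ =>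
          normSq (w i 0) + normSq (w i 1) + s * (-2 * (starRingEnd ℂ (w i 0) * (ξ * w i 1)).re) +
            s ^ 2 * normSq (ξ * w i 1) := by
        ext s
        simp only [horoHeight, normSq_apply, sub_re, sub_im, mul_re, mul_im, conj_re, conj_im,
          ofReal_re, ofReal_im]
        ring
      rw [e]
      have h2 := (((hasDerivAt_id (0 : ℝ)).mul_const
        (-2 * (starRingEnd ℂ (w i 0) * (ξ * w i 1)).re)).const_add
          (normSq (w i 0) + normSq (w i 1))).add
          ((hasDerivAt_pow 2 (0 : ℝ)).mul_const (normSq (ξ * w i 1)))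
      refine h2.congr_deriv ?_
      simp
    · simpa using hmin (s * ξ) 1 one_pos
  have ht : ∑ i, (normSq (w i 1) - normSq (w i 0)) /
      (normSq (w i 0) + normSq (w i 1)) = 0 := by
    have h := sum_div_eq_zero_of_prod_min
      (f := fun i (s : ℝ) => horoHeight (w i) 0 (Real.exp s))
      (f' := fun i => normSq (w i 1) - normSq (w i 0))
      (fun i => ?_) (fun i s => hpos i _ _ (Real.exp_pos s)) (fun s => ?_)
    · simpa [h01] using h
    · have e : (fun s : ℝ => horoHeight (w i) 0 (Real.exp s)) = fun s : ℝ =>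
          normSq (w i 0) * Real.exp (-s) + normSq (w i 1) * Real.exp s := by
        ext s
        have := Real.exp_pos s
        simp only [horoHeight, Real.exp_neg, zero_mul, sub_zero]
        field_simp
      rw [e]
      have h2 := ((hasDerivAt_neg (0 : ℝ)).exp.const_mul (normSq (w i 0))).add
        ((Real.hasDerivAt_exp 0).const_mul (normSq (w i 1)))
      refine h2.congr_deriv ?_
      simp
      ring
    · simpa using hmin 0 (Real.exp s) (Real.exp_pos s)
  -- The derivatives along `1`, `-I` and the vertical direction are minus the three coordinates of
  -- the sum.
  have h1 := hζ 1
  have h2 := hζ (-I)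
  ext k
  rw [WithLp.ofLp_sum, Finset.sum_apply, WithLp.ofLp_zero, Pi.zero_apply]
  fin_cases k
  · simp only [bloch, Fin.zero_eta, Matrix.cons_val_zero]
    rw [← neg_eq_zero, ← Finset.sum_neg_distrib]
    simpa [neg_div] using h1
  · simp only [bloch, Fin.mk_one, Matrix.cons_val_one, Matrix.cons_val_zero]
    rw [← neg_eq_zero, ← Finset.sum_neg_distrib]
    convert h2 using 2 with i
    simp
    ring
  · simp only [bloch, Fin.reduceFinMk, Matrix.cons_val]
    rw [← neg_eq_zero, ← Finset.sum_neg_distrib]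
    convert ht using 2 with i
    ring

theorem exists_sum_bloch_eq_zero {ι : Type*} [Fintype ι] (hι : 3 ≤ Fintype.card ι)
    (v : ι → Fin 2 → ℂ) (hv0 : ∀ i, v i ≠ 0) (hv : ∀ i j, i ≠ j → wedge (v i) (v j) ≠ 0) :
    ∃ g : GL (Fin 2) ℂ, ∑ i, bloch (g.1.mulVec (v i)) = 0 := by
  obtain ⟨ζ₀, t₀, ht₀, hmin⟩ := exists_min_prod_horoHeight hι v hv
  -- The map `z ↦ (z - ζ₀) / t₀` carries the minimum to `(0, 1)` and scales all heights by `t₀`.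
  obtain ⟨g, hg⟩ := exists_mulVec_eq 1 (-ζ₀) 0 t₀ (by simp [ht₀.ne'])
  have hgv : ∀ i, g.1.mulVec (v i) = ![v i 0 - ζ₀ * v i 1, t₀ * v i 1] := fun i => by
    rw [hg, one_mul, zero_mul, zero_add, neg_mul, ← sub_eq_add_neg]
  have hh : ∀ i ζ t, 0 < t → horoHeight (g.1.mulVec (v i)) ζ t =
      t₀ * horoHeight (v i) (ζ₀ + ζ * t₀) (t * t₀) := fun i ζ t ht => by
    rw [hgv]
    simp only [horoHeight, Matrix.cons_val_zero, Matrix.cons_val_one, map_mul, normSq_ofReal]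
    rw [show v i 0 - ζ₀ * v i 1 - ζ * (t₀ * v i 1) = v i 0 - (ζ₀ + ζ * t₀) * v i 1 by ring]
    field_simp
  refine ⟨g, sum_bloch_eq_zero _ (fun i => mulVec_ne_zero g (hv0 i)) fun ζ t ht => ?_⟩
  simp only [hh _ _ _ one_pos, hh _ _ _ ht, Finset.prod_mul_distrib]
  refine mul_le_mul_of_nonneg_left ?_ (by positivity)
  simpa using hmin (ζ₀ + ζ * t₀) (t * t₀) (by positivity)

end Barycenter

/-! ### Discs as Hermitian inequalities in homogeneous coordinates -/

section Disc

open Complex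

/-- Homogeneous coordinates of a point of the Riemann sphere. -/
noncomputable def homogeneous : OnePoint ℂ → Fin 2 → ℂ
  | OnePoint.infty => ![1, 0]
  | OnePoint.some z => ![z, 1]

@[simp] theorem homogeneous_infty : homogeneous OnePoint.infty = ![1, 0] := rfl

@[simp] theorem homogeneous_coe (z : ℂ) : homogeneous (z : OnePoint ℂ) = ![z, 1] := rfl

theorem homogeneous_ne_zero (x : OnePoint ℂ) : homogeneous x ≠ 0 := by
  intro h
  induction x using OnePoint.rec with
  | infty => simpa using congrFun h 0
  | coe z => simpa using congrFun h 1

theorem wedge_homogeneous_ne_zero {x y : OnePoint ℂ} (h : x ≠ y) :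
    wedge (homogeneous x) (homogeneous y) ≠ 0 := by
  induction x using OnePoint.rec with
  | infty =>
    induction y using OnePoint.rec with
    | infty => exact absurd rfl h
    | coe w => simp [wedge]
  | coe z =>
    induction y using OnePoint.rec with
    | infty => simp [wedge]
    | coe w => simpa [wedge, sub_eq_zero] using h

theorem wedge_mulVec (g : Matrix (Fin 2) (Fin 2) ℂ) (v w : Fin 2 → ℂ) :
    wedge (g.mulVec v) (g.mulVec w) = g.det * wedge v w := by
  simp only [wedge, Matrix.mulVec_fin_two, Matrix.det_fin_two, Matrix.cons_val_zero,
    Matrix.cons_val_one]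
  ring

theorem smul_mem_closedUnitDisc_iff (g : GL (Fin 2) ℂ) (x : OnePoint ℂ) :
    g • x ∈ closedUnitDisc ↔
      normSq (g.1.mulVec (homogeneous x) 0) ≤ normSq (g.1.mulVec (homogeneous x) 1) := by
  have key : ∀ a c : ℂ, (![a, c] : Fin 2 → ℂ) ≠ 0 →
      ((if c = 0 then OnePoint.infty else ((a / c : ℂ) : OnePoint ℂ)) ∈ closedUnitDisc ↔
        normSq a ≤ normSq c) := by
    intro a c hac
    split_ifs with hc
    · have ha : a ≠ 0 := fun ha => hac (by simp [ha, hc])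
      simp [closedUnitDisc, hc, ha]
    · simp only [closedUnitDisc, Set.mem_image, OnePoint.coe_eq_coe, exists_eq_right,
        mem_closedBall_zero_iff, norm_div, normSq_eq_norm_sq]
      rw [div_le_one (norm_pos_iff.2 hc), sq_le_sq₀ (norm_nonneg _) (norm_nonneg _)]
  have hne := mulVec_ne_zero g (homogeneous_ne_zero x)
  induction x using OnePoint.rec with
  | infty =>
    rw [OnePoint.smul_infty_eq_ite]
    simp only [homogeneous_infty, Matrix.mulVec_fin_two, Matrix.cons_val_zero,
      Matrix.cons_val_one, mul_one, mul_zero, add_zero] at hne ⊢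
    exact key _ _ hne
  | coe z =>
    rw [OnePoint.smul_some_eq_ite]
    simp only [homogeneous_coe, Matrix.mulVec_fin_two, Matrix.cons_val_zero,
      Matrix.cons_val_one, mul_one] at hne ⊢
    exact key _ _ hne

theorem isClosedDisc_setOf_normSq_le (g : GL (Fin 2) ℂ) :
    IsClosedDisc {x | normSq (g.1.mulVec (homogeneous x) 0) ≤
      normSq (g.1.mulVec (homogeneous x) 1)} := by
  refine ⟨g⁻¹, ?_⟩
  ext x
  rw [Set.mem_ofPred_eq, ← smul_mem_closedUnitDisc_iff, Set.mem_image]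
  constructor
  · exact fun h => ⟨g • x, h, inv_smul_smul g x⟩
  · rintro ⟨y, hy, rfl⟩
    simpa using hy

/-- An indefinite Hermitian form on `ℂ²` is, up to a positive factor, the pullback of
`‖v 0‖² - ‖v 1‖²` by an invertible matrix. -/
theorem exists_normSq_le_iff_hermitian_nonpos (A C : ℝ) (B : ℂ) (h : A * C < normSq B) :
    ∃ g : GL (Fin 2) ℂ, ∀ v : Fin 2 → ℂ,
      normSq (g.1.mulVec v 0) ≤ normSq (g.1.mulVec v 1) ↔
        A * normSq (v 0) + 2 * (B * v 0 * starRingEnd ℂ (v 1)).re + C * normSq (v 1) ≤ 0 := by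
  set δ := normSq B - A * C with hδ
  have hδ0 : 0 < δ := sub_pos.2 h
  have hs : ((Real.sqrt δ : ℝ) : ℂ) ≠ 0 := by simpa using (Real.sqrt_pos.2 hδ0).ne'
  have hsq : Real.sqrt δ * Real.sqrt δ = δ := Real.mul_self_sqrt hδ0.le
  -- Completing the square, for `A ≠ 0`. For `A = 0` the form is instead half a difference of two
  -- squares.
  have expand : ∀ x y : ℂ, normSq (A * x + starRingEnd ℂ B * y) = A * (A * normSq x +
      2 * (B * x * starRingEnd ℂ y).re + C * normSq y) + δ * normSq y := by
    intro x y
    simp only [hδ, normSq_apply, add_re, add_im, mul_re, mul_im, conj_re, conj_im, ofReal_re,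
      ofReal_im]
    ring
  rcases lt_trichotomy A 0 with hA | hA | hA
  · obtain ⟨g, hg⟩ := exists_mulVec_eq 0 (Real.sqrt δ) A (starRingEnd ℂ B) (by simp [hs, hA.ne])
    refine ⟨g, fun v => ?_⟩
    rw [hg, Matrix.cons_val_zero, Matrix.cons_val_one, Matrix.cons_val_zero, expand, zero_mul,
      zero_add, map_mul, normSq_ofReal, hsq, le_add_iff_nonneg_left, ← neg_mul_neg,
      mul_nonneg_iff_of_pos_left (neg_pos.2 hA), neg_nonneg]
  · have hB : B ≠ 0 := by
      rintro rfl
      simp [hA] at h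
    obtain ⟨g, hg⟩ := exists_mulVec_eq B (C / 2 + 1) B (C / 2 - 1) (by
      rw [show B * ((C : ℂ) / 2 - 1) - (C / 2 + 1) * B = -2 * B by ring]
      simpa using hB)
    have e : ∀ x y : ℂ, normSq (B * x + (C / 2 + 1) * y) - normSq (B * x + (C / 2 - 1) * y) =
        2 * (A * normSq x + 2 * (B * x * starRingEnd ℂ y).re + C * normSq y) := by
      intro x y
      rw [show (C : ℂ) / 2 = ((C / 2 : ℝ) : ℂ) by push_cast; rfl, hA]
      simp only [normSq_apply, add_re, add_im, sub_re, sub_im, mul_re, mul_im, conj_re, conj_im,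
        ofReal_re, ofReal_im, one_re, one_im]
      ring
    refine ⟨g, fun v => ?_⟩
    rw [hg, Matrix.cons_val_zero, Matrix.cons_val_one, Matrix.cons_val_zero, ← sub_nonpos, e]
    constructor <;> intro _ <;> linarith
  · obtain ⟨g, hg⟩ := exists_mulVec_eq A (starRingEnd ℂ B) 0 (Real.sqrt δ) (by simp [hs, hA.ne'])
    refine ⟨g, fun v => ?_⟩
    rw [hg, Matrix.cons_val_zero, Matrix.cons_val_one, Matrix.cons_val_zero, expand, zero_mul,
      zero_add, map_mul, normSq_ofReal, hsq, add_le_iff_nonpos_left, ← neg_nonneg, ← mul_neg,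
      mul_nonneg_iff_of_pos_left hA, neg_nonneg]

/-- Spherical caps are closed discs. -/
theorem isClosedDisc_setOf_le_inner_bloch (g : GL (Fin 2) ℂ) (p : EuclideanSpace ℝ (Fin 3))
    {r : ℝ} (hr : r ^ 2 < ‖p‖ ^ 2) :
    IsClosedDisc {x | r ≤ inner ℝ (bloch (g.1.mulVec (homogeneous x))) p} := by
  -- Clearing the denominator of `bloch` turns the cap into a Hermitian form of determinant `r² -
  -- ‖p‖²`, negative by `hr`.
  obtain ⟨k, hk⟩ := exists_normSq_le_iff_hermitian_nonpos (r - p 2) (r + p 2)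
    (-(p 0 + p 1 * I)) (by
      rw [EuclideanSpace.norm_sq_eq, Fin.sum_univ_three] at hr
      simp only [Real.norm_eq_abs, sq_abs] at hr
      rw [normSq_neg, normSq_add_mul_I]
      linarith)
  convert isClosedDisc_setOf_normSq_le (k * g) using 1
  ext x
  have hv := mulVec_ne_zero g (homogeneous_ne_zero x)
  have hN := normSq_add_normSq_pos hv
  rw [Set.mem_ofPred_eq, Set.mem_ofPred_eq, Units.val_mul, ← Matrix.mulVec_mulVec, hk]
  generalize g.1.mulVec (homogeneous x) = v at hN ⊢
  have e : inner ℝ (bloch v) p = (2 * (starRingEnd ℂ (v 0) * v 1).re * p 0 +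
      2 * (starRingEnd ℂ (v 0) * v 1).im * p 1 + (normSq (v 0) - normSq (v 1)) * p 2) /
        (normSq (v 0) + normSq (v 1)) := by
    simp only [bloch, PiLp.inner_apply, Fin.sum_univ_three, Matrix.cons_val_zero,
      Matrix.cons_val_one, Matrix.cons_val, RCLike.inner_apply, conj_trivial]
    ring
  rw [e, le_div_iff₀ hN, ← sub_nonpos]
  refine iff_of_eq (congrArg (· ≤ 0) ?_)
  simp only [normSq_apply, neg_re, neg_im, add_re, add_im, mul_re, mul_im, conj_re, conj_im,
    ofReal_re, ofReal_im, I_re, I_im]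
  ring

end Disc

/-! ### The three discs -/

theorem theorem1 (A : Set (OnePoint ℂ)) (hA : A.ncard = 6) :
    ∃ D : Fin 3 → Set (OnePoint ℂ),
      (∀ j, IsClosedDisc (D j)) ∧
      (∀ i j, i ≠ j → Disjoint (D i) (D j)) ∧
      (∀ j, (D j ∩ A).ncard = 2) := by
  have hfin : A.Finite := Set.finite_of_ncard_ne_zero (by omega)
  have : Finite A := hfin
  obtain ⟨e⟩ : Nonempty (Fin 3 × Bool ≃ A) := by
    rw [← Finite.card_eq, Nat.card_coe_set_eq, hA]
    simp
  obtain ⟨g, hg⟩ := exists_sum_bloch_eq_zero (ι := Fin 3 × Bool) (by simp)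
    (fun i => homogeneous (e i)) (fun i => homogeneous_ne_zero _)
    (fun i j hij => wedge_homogeneous_ne_zero fun h => hij (e.injective (Subtype.ext h)))
  set β : OnePoint ℂ → EuclideanSpace ℝ (Fin 3) :=
    fun x => bloch (g.1.mulVec (homogeneous x)) with hβ
  have hβ1 : ∀ x, ‖β x‖ = 1 := fun x => norm_bloch (mulVec_ne_zero g (homogeneous_ne_zero x))
  have hβne : ∀ x y, x ≠ y → inner ℝ (β x) (β y) < 1 := fun x y hxy => by
    have hx := mulVec_ne_zero g (homogeneous_ne_zero x)
    have hy := mulVec_ne_zero g (homogeneous_ne_zero y)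
    rw [hβ, inner_bloch hx hy, wedge_mulVec]
    have h1 := normSq_add_normSq_pos hx
    have h2 := normSq_add_normSq_pos hy
    have h3 : 0 < Complex.normSq (g.1.det * wedge (homogeneous x) (homogeneous y)) :=
      Complex.normSq_pos.2 (mul_ne_zero g.det_ne_zero (wedge_homogeneous_ne_zero hxy))
    have := div_pos h3 (mul_pos h1 h2)
    linarith
  obtain ⟨σ, hσ, hdisj⟩ := exists_pairing_disjoint_caps (fun i => β (e i)) (fun i => hβ1 _)
    (fun i j hij => hβne _ _ fun h => hij (e.injective (Subtype.ext h))) hg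
  set p : Fin 3 → EuclideanSpace ℝ (Fin 3) :=
    fun j => β (e (σ (j, true))) + β (e (σ (j, false))) with hp
  set D : Fin 3 → Set (OnePoint ℂ) := fun j => {x | ‖p j‖ ^ 2 / 2 ≤ inner ℝ (β x) (p j)} with hD
  have hD_disj : ∀ i j, i ≠ j → Disjoint (D i) (D j) := fun i j hij =>
    Set.disjoint_left.2 fun x hi hj => hdisj i j hij (β x) (hβ1 x) hi hj
  -- Both points lie on the boundary circle: `⟪a, a + b⟫ = 1 + ⟪a, b⟫ = ‖a + b‖² / 2`.
  have hmem : ∀ j b, (e (σ (j, b)) : OnePoint ℂ) ∈ D j := by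
    intro j b
    simp only [hD, hp, Set.mem_ofPred_eq]
    rw [norm_add_sq_real, hβ1, hβ1]
    cases b
    · rw [inner_add_right, real_inner_self_eq_norm_sq, hβ1,
        real_inner_comm (β (e (σ (j, true))))]
      linarith
    · rw [inner_add_right, real_inner_self_eq_norm_sq, hβ1]
      linarith
  refine ⟨D, fun j => ?_, hD_disj, fun j => ?_⟩
  · refine isClosedDisc_setOf_le_inner_bloch g (p j) ?_
    -- `(‖p‖² / 2)² < ‖p‖²` because `0 < ‖p‖² < 4`.
    nlinarith [hσ j]
  · have : D j ∩ A = {(e (σ (j, true)) : OnePoint ℂ), (e (σ (j, false)) : OnePoint ℂ)} := by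
      ext x
      simp only [Set.mem_inter_iff, Set.mem_insert_iff, Set.mem_singleton_iff]
      constructor
      · rintro ⟨hxD, hxA⟩
        obtain ⟨⟨i, b⟩, hi⟩ := (σ.trans e).surjective ⟨x, hxA⟩
        have hx : x = e (σ (i, b)) := by
          rw [Equiv.trans_apply] at hi
          rw [hi]
        obtain rfl : i = j := by
          by_contra hij
          exact Set.disjoint_left.1 (hD_disj i j hij) (hx ▸ hmem i b) hxD
        cases b
        exacts [Or.inr hx, Or.inl hx]
      · rintro (rfl | rfl)
        exacts [⟨hmem j true, (e _).2⟩, ⟨hmem j false, (e _).2⟩]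
    rw [this, Set.ncard_pair]
    intro h
    simpa using σ.injective (e.injective (Subtype.ext h))
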